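/- Let $d,r\in\mathbb N=\{1,2,\dots\}$ and $\mathbb T=\mathbb R/\mathbb Z$. Let $H^r_{\mathrm{mix}}(\mathbb T^d)$ be the space of (real- or complex-valued) continuous functions $f$ on $\mathbb T^d$ with $$\|f\|_{H^r_{\mathrm{mix}}}^2=\sum_{\boldsymbol k\in\mathbb Z^d}\ \prod_{i=1}^d\bigl(1+|2\pi k_i|^{2r}\bigr)\,|\hat f(\boldsymbol k)|^2<\infty,\qquad \hat f(\boldsymbol k)=\int_{[0,1]^d}f(\boldsymbol x)e^{-2\pi i\,\boldsymbol k\cdot\boldsymbol x}\,d\boldsymbol x$$ (equivalently, $\|f\|_{H^r_{\mathrm{mix}}}^2=\sum_{e\subseteq\{1,\dots,d\}}\|(\prod_{i\in e}\partial_{x_i}^{r})f\|_{L_2}^2$ with weak derivatives). For $n\in\mathbb N$ let $Q_n(f)=\frac1n\sum_{j=0}^{n-1}f(j/n)$ be the univariate trapezoidal rule, put $\Delta_0=Q_1$, $\Delta_k=Q_{2^k}-Q_{2^{k-1}}$ for $k\ge1$, and define the sparse grid cubature rule of level $L\in\mathbb N$ by $$Q_L^{sg}=\sum_{\boldsymbol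 k\in\mathbb N_0^d,\ k_1+\dots+k_d\le L}\Delta_{k_1}\otimes\dots\otimes\Delta_{k_d}.$$ Let $N=N_L$ be its number of nodes, i.e. the number of points of the sparse grid $\bigcup_{k_1+\dots+k_d\le L}\prod_{j=1}^d\{i2^{-k_j}:0\le i<2^{k_j}\}\subset\mathbb T^d$. Then there are constants $c,C>0$, independent of $L$ (they may depend on $d$ and $r$), such that for all $L\in\mathbb N$ $$c\,N^{-r}(\log N)^{(d-1)(r+1/2)}\ \le\ \sup_{\|f\|_{H^r_{\mathrm{mix}}}\le1}\Bigl|\int_{[0,1]^d}f(\boldsymbol x)\,d\boldsymbol x-Q_L^{sg}(f)\Bigr|\ \le\ C\,N^{-r}(\log N)^{(d-1)(r+1/2)}.$$ -/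

import Mathlib

open MeasureTheory
open scoped ENNReal

noncomputable section

namespace SparseGrid

/-! ### The periodic Sobolev space of dominating mixed smoothness -/

/-- The uniform probability measure on `𝕋^d = (ℝ / ℤ)^d`, i.e. Lebesgue measure on `[0,1]^d`. -/
def torusMeasure (d : ℕ) : Measure (UnitAddTorus (Fin d)) :=
  Measure.pi fun _ => (AddCircle.haarAddCircle : Measure UnitAddCircle)

/-- The integral of `f` over `[0,1]^d`, one period of `𝕋^d`. -/
def torusIntegral {𝕜 : Type*} [RCLike 𝕜] {d : ℕ} (f : UnitAddTorus (Fin d) → 𝕜) : 𝕜 :=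
  ∫ x, f x ∂(torusMeasure d)

/-- The Fourier coefficient `∫ f(x) exp(-2πi k⬝x) dx` of a real- or complex-valued function on
`𝕋^d`; the map `RCLike.map 𝕜 ℂ` is the inclusion of `𝕜` (that is, `ℝ` or `ℂ`) into `ℂ`. -/
def torusFourierCoeff {𝕜 : Type*} [RCLike 𝕜] {d : ℕ} (f : UnitAddTorus (Fin d) → 𝕜)
    (k : Fin d → ℤ) : ℂ :=
  UnitAddTorus.mFourierCoeff (fun x => RCLike.map 𝕜 ℂ (f x)) k

/-- The weight `∏ i, (1 + |2π k_i|^(2r))`. -/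
def mixWeight {d : ℕ} (r : ℕ) (k : Fin d → ℤ) : ℝ :=
  ∏ i, (1 + |2 * Real.pi * (k i : ℝ)| ^ (2 * r))

/-- The norm of `f` in `H^r_mix(𝕋^d)`,
`(∑ k, ∏ i (1 + |2π k_i|^(2r)) |f̂(k)|²)^(1/2)`, with value `∞` if the series diverges. By
Parseval's identity, its square is the sum over all `e ⊆ {1,…,d}` of the squared `L₂` norms of the
mixed weak derivatives `(∏ i ∈ e, ∂^r/∂x_i^r) f`. -/
def mixNorm {𝕜 : Type*} [RCLike 𝕜] {d : ℕ} (r : ℕ) (f : UnitAddTorus (Fin d) → 𝕜) : ℝ≥0∞ :=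
  (∑' k : Fin d → ℤ, ENNReal.ofReal (mixWeight r k * ‖torusFourierCoeff f k‖ ^ 2)) ^ (1 / 2 : ℝ)

/-- The space `H^r_mix(𝕋^d)`, for `r ≥ 1`: every class of functions with finite norm has exactly
one continuous representative, and the space is the set of these representatives. -/
def mixSpace (𝕜 : Type*) [RCLike 𝕜] (d r : ℕ) : Set (UnitAddTorus (Fin d) → 𝕜) :=
  {f | Continuous f ∧ mixNorm r f < ∞}

/-! ### Cubature rules -/

/-- A cubature rule with finitely many nodes in `X` is given by the real weight of each node. -/
abbrev CubatureRule (X : Type*) := X →₀ ℝ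

/-- The value `∑ x, w(x) f(x)` of a cubature rule at a function `f`. -/
def CubatureRule.apply {X 𝕜 : Type*} [RCLike 𝕜] (Q : CubatureRule X) (f : X → 𝕜) : 𝕜 :=
  Q.sum fun x w => (w : 𝕜) * f x

/-- The `N`-point trapezoidal rule `Q_N(f) = ∑_{j < N} (1/N) f(j/N)` on `𝕋 = ℝ / ℤ`. -/
def trapezoid (N : ℕ) : CubatureRule UnitAddCircle :=
  ∑ j ∈ Finset.range N, Finsupp.single (((j : ℝ) / (N : ℝ) : ℝ) : UnitAddCircle) (1 / (N : ℝ))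

/-- The hierarchical rules `Δ_0 = Q_1` and `Δ_k = Q_{2^k} - Q_{2^(k-1)}` for `k ≥ 1`. -/
def hierDiff : ℕ → CubatureRule UnitAddCircle
  | 0 => trapezoid 1
  | k + 1 => trapezoid (2 ^ (k + 1)) - trapezoid (2 ^ k)

/-- The tensor product of univariate rules: the node `(x_1,…,x_d)` has the weight
`∏ j, q_j(x_j)`. -/
def tensorRule {d : ℕ} (q : Fin d → CubatureRule UnitAddCircle) :
    CubatureRule (UnitAddTorus (Fin d)) :=
  Finsupp.onFinset (Fintype.piFinset fun j => (q j).support) (fun x => ∏ j, q j (x j)) <| by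
    intro x hx
    rw [Fintype.mem_piFinset]
    intro j
    rw [Finsupp.mem_support_iff]
    exact Finset.prod_ne_zero_iff.mp hx j (Finset.mem_univ j)

/-- The multi-indices `k ∈ ℕ₀^d` with `k_1 + ⋯ + k_d ≤ L`. -/
def levels (d L : ℕ) : Finset (Fin d → ℕ) :=
  (Fintype.piFinset fun _ => Finset.range (L + 1)).filter fun k => ∑ j, k j ≤ L

/-- The sparse grid cubature rule `Q_L^sg = ∑_{|k|_1 ≤ L} Δ_{k_1} ⊗ ⋯ ⊗ Δ_{k_d}`. -/
def sparseGridRule (d L : ℕ) : CubatureRule (UnitAddTorus (Fin d)) :=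
  ∑ k ∈ levels d L, tensorRule fun j => hierDiff (k j)

/-- The nodes `i / 2^k`, `0 ≤ i < 2^k`, of the trapezoidal rule on `2^k` points. -/
def dyadicNodes (k : ℕ) : Set UnitAddCircle :=
  {x | ∃ i : ℕ, i < 2 ^ k ∧ x = (((i : ℝ) / (2 : ℝ) ^ k : ℝ) : UnitAddCircle)}

/-- The sparse grid of level `L`: the union of the product grids with `2^(k_1), …, 2^(k_d)` points
per direction over all `k_1 + ⋯ + k_d ≤ L`. -/
def sparseGridNodes (d L : ℕ) : Set (UnitAddTorus (Fin d)) :=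
  {x | ∃ k : Fin d → ℕ, ∑ j, k j ≤ L ∧ ∀ j, x j ∈ dyadicNodes (k j)}

/-- The number `N_L` of nodes of the sparse grid cubature rule of level `L`. -/
def numNodes (d L : ℕ) : ℕ := (sparseGridNodes d L).ncard

/-- The worst-case integration error of a cubature rule `Q` on the unit ball of `H^r_mix(𝕋^d)`. -/
def worstCaseError (𝕜 : Type*) [RCLike 𝕜] {d : ℕ} (r : ℕ)
    (Q : CubatureRule (UnitAddTorus (Fin d))) : ℝ≥0∞ :=
  ⨆ f ∈ {f ∈ mixSpace 𝕜 d r | mixNorm r f ≤ 1}, ‖torusIntegral f - Q.apply f‖ₑ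

/-- The rate `N^(-r) (log N)^((d-1)(r+1/2))`. -/
def sparseGridRate (d r N : ℕ) : ℝ :=
  (N : ℝ) ^ (-(r : ℝ)) * Real.log N ^ (((d : ℝ) - 1) * ((r : ℝ) + 1 / 2))

end SparseGrid

end

open MeasureTheory
open scoped ENNReal

noncomputable section

namespace SparseGrid

/-! ### Counting compositions -/

/-! By aliasing, `Δ_m` sends the character of frequency `k` to `1` if `m = 0`, to `-1` if `m > 0` is
the first level that sees `k` (`freqLevel k`), and to `0` otherwise. Summed over all tuples of
levels, the tensor products therefore integrate each character exactly. Truncating to total level at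
most `L` loses nothing if the levels of the frequencies `k_j` add up to at most `L`
(`charError_eq_zero`), loses exactly one term `±1` if they add up to `L + 1`
(`charError_of_sum_eq`), and always leaves an error of at most `1 + 2^d` (`norm_charError_le`).

Upper bound: Cauchy-Schwarz bounds the squared worst-case error by the sum of inverse weights over
total level above `L`. Univariate frequencies of level `u` contribute `O(4^(-ru))`, and there are
about `n^(d-1)` tuples of total level `n`, so this sum is `O(4^(-rL) L^(d-1))`
(`exists_weightTail_le`).

Lower bound: take one cosine for each tuple of total level `L + 1`, with signs making all errors add
up (`le_worstCaseError`). Both bounds have order `2^(-rL) L^((d-1)/2)`.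

Finally `N` is of order `L^(d-1) 2^L` and `log N` of order `L`. Expressing `2^(-rL)` by `N^(-r)`
costs `L^((d-1)r)`, whence the exponent `(d-1)(r+1/2)`. -/

theorem card_piAntidiag_le (m n : ℕ) :
    ((Finset.univ : Finset (Fin (m + 1))).piAntidiag n).card ≤ (n + 1) ^ m := by
  have h : (Fintype.piFinset fun _ : Fin m => Finset.range (n + 1)).card = (n + 1) ^ m := by
    simp [Fintype.card_piFinset]
  rw [← h]
  refine Finset.card_le_card_of_injOn Fin.tail ?_ ?_
  · intro u hu
    have hu' : ∑ j, u j = n := by simpa using hu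
    simp only [Finset.mem_coe, Fintype.mem_piFinset, Finset.mem_range, Fin.tail]
    intro j
    have := Finset.single_le_sum (f := u) (fun i _ => Nat.zero_le _) (Finset.mem_univ j.succ)
    omega
  · intro u hu v hv huv
    have hu' : ∑ j, u j = n := by simpa using hu
    have hv' : ∑ j, v j = n := by simpa using hv
    rw [Fin.sum_univ_succ] at hu' hv'
    have ht : ∀ j : Fin m, u j.succ = v j.succ := fun j => congrFun huv j
    have h0 : u 0 = v 0 := by simp only [ht] at hu'; omega
    funext j
    refine Fin.cases h0 ht j

/-- Any `m` entries of size at most `n / (m + 1)` have sum at most `n`, and one further entry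
completes them to a composition of `n`. -/
theorem le_card_piAntidiag (m n : ℕ) :
    (n + 1) ^ m ≤ (m + 1) ^ m * ((Finset.univ : Finset (Fin (m + 1))).piAntidiag n).card := by
  have h : (Fintype.piFinset fun _ : Fin m => Finset.range (n / (m + 1) + 1)).card =
      (n / (m + 1) + 1) ^ m := by
    simp [Fintype.card_piFinset]
  have h1 : (n / (m + 1) + 1) ^ m ≤ ((Finset.univ : Finset (Fin (m + 1))).piAntidiag n).card := by
    rw [← h]
    refine Finset.card_le_card_of_injOn
      (fun v => (Fin.cons (n - ∑ j, v j) v : Fin (m + 1) → ℕ)) ?_ ?_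
    · intro v hv
      have hv' : ∀ j, v j ≤ n / (m + 1) := by
        simpa [Nat.lt_succ_iff] using hv
      have h2 : ∑ j, v j ≤ n := calc
        ∑ j, v j ≤ ∑ _j : Fin m, n / (m + 1) := Finset.sum_le_sum fun j _ => hv' j
        _ = m * (n / (m + 1)) := by simp
        _ ≤ (m + 1) * (n / (m + 1)) := by gcongr; omega
        _ ≤ n := Nat.mul_div_le _ _
      simp [Fin.sum_univ_succ, h2]
    · intro u _ v _ huv
      exact (Fin.cons_inj.mp huv).2
  calc (n + 1) ^ m ≤ ((m + 1) * (n / (m + 1) + 1)) ^ m := by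
        gcongr
        have := Nat.lt_mul_div_succ n (Nat.succ_pos m)
        simpa using this
    _ = (m + 1) ^ m * (n / (m + 1) + 1) ^ m := mul_pow _ _ _
    _ ≤ _ := by gcongr

/-! ### Counting the nodes of the sparse grid -/

open Classical in
/-- The dyadic nodes of level `k` as a finite set. -/
def dyadicFinset (k : ℕ) : Finset UnitAddCircle :=
  (Finset.range (2 ^ k)).image fun i : ℕ => (((i : ℝ) / (2 : ℝ) ^ k : ℝ) : UnitAddCircle)

theorem mem_dyadicFinset {k : ℕ} {x : UnitAddCircle} : x ∈ dyadicFinset k ↔ x ∈ dyadicNodes k := by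
  simp only [dyadicFinset, dyadicNodes, Finset.mem_image, Finset.mem_range, Set.mem_ofPred_eq]
  exact ⟨fun ⟨i, h, e⟩ => ⟨i, h, e.symm⟩, fun ⟨i, h, e⟩ => ⟨i, h, e.symm⟩⟩

theorem card_dyadicFinset (k : ℕ) : (dyadicFinset k).card = 2 ^ k := by
  rw [dyadicFinset, Finset.card_image_of_injOn, Finset.card_range]
  intro i hi j hj hij
  have h2 : (0 : ℝ) < 2 ^ k := by positivity
  have hmem : ∀ i : ℕ, i ∈ (Finset.range (2 ^ k) : Set ℕ) →
      (i : ℝ) / (2 : ℝ) ^ k ∈ Set.Ico (0 : ℝ) (0 + 1) := by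
    intro i hi
    have hi' : i < 2 ^ k := by simpa using hi
    refine ⟨by positivity, ?_⟩
    rw [zero_add, div_lt_one h2]
    exact_mod_cast hi'
  have := (AddCircle.coe_eq_coe_iff_of_mem_Ico (p := (1 : ℝ)) (hmem i hi) (hmem j hj)).mp hij
  rw [div_left_inj' h2.ne'] at this
  exact_mod_cast this

theorem dyadicFinset_mono : Monotone dyadicFinset := by
  refine monotone_nat_of_le_succ fun k x hx => ?_
  rw [mem_dyadicFinset] at hx ⊢
  obtain ⟨i, hi, rfl⟩ := hx
  refine ⟨2 * i, by rw [pow_succ]; omega, ?_⟩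
  congr 1
  push_cast
  rw [pow_succ, mul_comm, mul_div_mul_right _ _ two_ne_zero]

open Classical in
/-- The nodes of level exactly `k`. -/
def newNodes (k : ℕ) : Finset UnitAddCircle := disjointed dyadicFinset k

theorem two_pow_le_card_newNodes (k : ℕ) : 2 ^ k ≤ 2 * (newNodes k).card := by
  classical
  cases k with
  | zero =>
    have : newNodes 0 = dyadicFinset 0 := disjointed_zero _
    rw [this, card_dyadicFinset]; norm_num
  | succ k =>
    have : newNodes (k + 1) = dyadicFinset (k + 1) \ dyadicFinset k :=
      dyadicFinset_mono.disjointed_succ (not_isMax k)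
    rw [this, Finset.card_sdiff_of_subset (dyadicFinset_mono (Nat.le_succ k)), card_dyadicFinset,
      card_dyadicFinset, pow_succ]
    omega

/-- Union bound: each product grid of total level `s` has `2^s` points. -/
theorem exists_finset_eq_sparseGridNodes (d L : ℕ) : ∃ S : Finset (UnitAddTorus (Fin d)),
    (S : Set (UnitAddTorus (Fin d))) = sparseGridNodes d L ∧
    S.card ≤ ∑ s ∈ Finset.range (L + 1),
      ((Finset.univ : Finset (Fin d)).piAntidiag s).card * 2 ^ s := by
  classical
  refine ⟨(Finset.range (L + 1)).biUnion fun s => ((Finset.univ : Finset (Fin d)).piAntidiag s).biUnion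
    fun k => Fintype.piFinset fun j => dyadicFinset (k j), ?_, ?_⟩
  · ext x
    simp only [Finset.coe_biUnion, Set.mem_iUnion, Finset.mem_coe, Finset.mem_range,
      Finset.mem_piAntidiag, Fintype.mem_piFinset, mem_dyadicFinset, sparseGridNodes,
      Set.mem_ofPred_eq, exists_prop, Nat.lt_succ_iff]
    constructor
    · rintro ⟨s, hs, k, ⟨hk, -⟩, h⟩
      exact ⟨k, hk.trans_le hs, h⟩
    · rintro ⟨k, hk, h⟩
      exact ⟨_, hk, k, ⟨rfl, fun _ _ => Finset.mem_univ _⟩, h⟩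
  · refine Finset.card_biUnion_le.trans (Finset.sum_le_sum fun s _ => ?_)
    refine Finset.card_biUnion_le.trans ?_
    rw [Finset.card_eq_sum_ones, Finset.sum_mul]
    refine Finset.sum_le_sum fun k hk => ?_
    rw [Fintype.card_piFinset]
    simp only [card_dyadicFinset, Finset.prod_pow_eq_pow_sum, one_mul]
    have : ∑ j, k j = s := by simpa using hk
    rw [this]

theorem finite_sparseGridNodes (d L : ℕ) : (sparseGridNodes d L).Finite := by
  obtain ⟨S, hS, -⟩ := exists_finset_eq_sparseGridNodes d L
  exact hS ▸ S.finite_toSet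

theorem card_le_numNodes {d L : ℕ} (S : Finset (UnitAddTorus (Fin d)))
    (h : (S : Set (UnitAddTorus (Fin d))) ⊆ sparseGridNodes d L) : S.card ≤ numNodes d L := by
  rw [numNodes, ← Set.ncard_coe_finset]
  exact Set.ncard_le_ncard h (finite_sparseGridNodes d L)

theorem numNodes_le (m L : ℕ) : numNodes (m + 1) L ≤ 2 * ((L + 1) ^ m * 2 ^ L) := by
  obtain ⟨S, hS, hc⟩ := exists_finset_eq_sparseGridNodes (m + 1) L
  rw [numNodes, ← hS, Set.ncard_coe_finset]
  calc S.card ≤ _ := hc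
    _ ≤ ∑ s ∈ Finset.range (L + 1), (L + 1) ^ m * 2 ^ s := by
        refine Finset.sum_le_sum fun s hs => ?_
        gcongr
        refine (card_piAntidiag_le m s).trans ?_
        gcongr
        have := Finset.mem_range.mp hs
        omega
    _ = (L + 1) ^ m * (2 ^ (L + 1) - 1) := by
        rw [← Finset.mul_sum, Nat.geomSum_eq le_rfl]; simp
    _ ≤ (L + 1) ^ m * 2 ^ (L + 1) := by gcongr; exact Nat.sub_le _ _
    _ = _ := by ring

theorem two_pow_le_numNodes (m L : ℕ) : 2 ^ L ≤ numNodes (m + 1) L := by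
  classical
  let k : Fin (m + 1) → ℕ := Fin.cons L 0
  have hk : ∑ j, k j = L := by simp [k, Fin.sum_univ_succ]
  have := card_le_numNodes (L := L) (Fintype.piFinset fun j => dyadicFinset (k j)) (by
    intro x hx
    simp only [Finset.mem_coe, Fintype.mem_piFinset, mem_dyadicFinset] at hx
    exact ⟨k, hk.le, hx⟩)
  rw [Fintype.card_piFinset] at this
  simpa only [card_dyadicFinset, Finset.prod_pow_eq_pow_sum, hk] using this

/-- Products of the sets of new nodes are disjoint for distinct level tuples, so no overlap has to
be subtracted; passing to new nodes costs at most a factor `2` per coordinate. -/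
theorem le_numNodes (m L : ℕ) :
    (L + 1) ^ m * 2 ^ L ≤ (m + 1) ^ m * 2 ^ (m + 1) * numNodes (m + 1) L := by
  classical
  let T := (Finset.univ : Finset (Fin (m + 1))).piAntidiag L
  let S := T.biUnion fun k => Fintype.piFinset fun j => newNodes (k j)
  have hS : (S : Set (UnitAddTorus (Fin (m + 1)))) ⊆ sparseGridNodes (m + 1) L := by
    intro x hx
    simp only [S, T, Finset.coe_biUnion, Set.mem_iUnion, Finset.mem_coe, Finset.mem_piAntidiag,
      Fintype.mem_piFinset, exists_prop] at hx
    obtain ⟨k, ⟨hk, -⟩, h⟩ := hx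
    exact ⟨k, hk.le, fun j => mem_dyadicFinset.mp (disjointed_le dyadicFinset (k j) (h j))⟩
  have hcard : S.card = ∑ k ∈ T, ∏ j, (newNodes (k j)).card := by
    rw [Finset.card_biUnion]
    · simp only [Fintype.card_piFinset]
    · intro k _ l _ hkl
      obtain ⟨j, hj⟩ := Function.ne_iff.mp hkl
      rw [Function.onFun, Finset.disjoint_left]
      intro x hx hy
      rw [Fintype.mem_piFinset] at hx hy
      exact Finset.disjoint_left.mp (disjoint_disjointed dyadicFinset hj) (hx j) (hy j)
  have hprod : ∀ k ∈ T, 2 ^ L ≤ 2 ^ (m + 1) * ∏ j, (newNodes (k j)).card := by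
    intro k hk
    have hk' : ∑ j, k j = L := by simpa [T] using hk
    calc 2 ^ L = ∏ j, 2 ^ k j := by rw [Finset.prod_pow_eq_pow_sum, hk']
      _ ≤ ∏ j, 2 * (newNodes (k j)).card :=
        Finset.prod_le_prod' fun j _ => two_pow_le_card_newNodes (k j)
      _ = _ := by simp [Finset.prod_mul_distrib]
  calc (L + 1) ^ m * 2 ^ L ≤ (m + 1) ^ m * T.card * 2 ^ L := by
        gcongr; exact le_card_piAntidiag m L
    _ = (m + 1) ^ m * ∑ _k ∈ T, 2 ^ L := by simp; ring
    _ ≤ (m + 1) ^ m * ∑ k ∈ T, 2 ^ (m + 1) * ∏ j, (newNodes (k j)).card := by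
        gcongr with k hk; exact hprod k hk
    _ = (m + 1) ^ m * 2 ^ (m + 1) * S.card := by
        rw [hcard, ← Finset.mul_sum, mul_assoc]
    _ ≤ _ := by gcongr; exact card_le_numNodes S hS

/-! ### The sparse grid rule at the characters of the torus -/

/-- `CubatureRule.apply` as an additive map of the rule. -/
def applyHom {X 𝕜 : Type*} [RCLike 𝕜] (f : X → 𝕜) : CubatureRule X →+ 𝕜 :=
  Finsupp.liftAddHom fun x => (AddMonoidHom.mulRight (f x)).comp (algebraMap ℝ 𝕜).toAddMonoidHom

theorem applyHom_eq {X 𝕜 : Type*} [RCLike 𝕜] (f : X → 𝕜) (Q : CubatureRule X) :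
    Q.apply f = applyHom f Q := rfl

theorem applyHom_single {X 𝕜 : Type*} [RCLike 𝕜] (f : X → 𝕜) (x : X) (w : ℝ) :
    applyHom f (Finsupp.single x w) = (w : 𝕜) * f x := by
  simp [applyHom]

/-- The rule is a geometric sum over the powers of an `N`-th root of unity, which vanishes unless
the root is `1`. -/
theorem trapezoid_apply_fourier {N : ℕ} (hN : 0 < N) (k : ℤ) :
    (trapezoid N).apply (fun x => (fourier k x : ℂ)) = if (N : ℤ) ∣ k then 1 else 0 := by
  have hN' : (N : ℂ) ≠ 0 := by exact_mod_cast hN.ne'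
  set z : ℂ := Complex.exp (2 * Real.pi * Complex.I * k / N) with hz
  have hsum : (trapezoid N).apply (fun x => (fourier k x : ℂ)) =
      1 / N * ∑ j ∈ Finset.range N, z ^ j := by
    rw [applyHom_eq, trapezoid, map_sum, Finset.mul_sum]
    refine Finset.sum_congr rfl fun j _ => ?_
    rw [applyHom_single, fourier_coe_apply, hz, ← Complex.exp_nat_mul]
    push_cast
    congr 2
    field_simp
  have hzN : z ^ N = 1 := by
    rw [hz, ← Complex.exp_nat_mul, Complex.exp_eq_one_iff]
    exact ⟨k, by field_simp⟩
  have hz1 : z = 1 ↔ (N : ℤ) ∣ k := by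
    rw [hz, Complex.exp_eq_one_iff]
    constructor
    · rintro ⟨n, hn⟩
      refine ⟨n, ?_⟩
      have h2 := Complex.two_pi_I_ne_zero
      have : (k : ℂ) = N * n := by
        field_simp at hn
        exact hn.trans (by ring)
      exact_mod_cast this
    · rintro ⟨n, rfl⟩
      refine ⟨n, ?_⟩
      push_cast
      field_simp
  rw [hsum]
  split_ifs with h
  · rw [hz1.mpr h]; simp [hN']
  · have h1 : z - 1 ≠ 0 := sub_ne_zero.mpr fun h' => h (hz1.mp h')
    have := mul_geom_sum z N
    rw [hzN, sub_self] at this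
    rw [(mul_eq_zero.mp this).resolve_left h1, mul_zero]

/-- The first level at which the rules `hierDiff` see the frequency `k`: `0` if `k = 0`, and one
more than the `2`-adic valuation of `k` otherwise. -/
def freqLevel (k : ℤ) : ℕ := if k = 0 then 0 else padicValInt 2 k + 1

theorem freqLevel_eq_zero {k : ℤ} : freqLevel k = 0 ↔ k = 0 := by
  unfold freqLevel; split_ifs with h <;> simp [h]

/-- The value of `hierDiff m` at the character of frequency `k`. -/
def hierSymbol (m : ℕ) (k : ℤ) : ℂ := if m = 0 then 1 else if m = freqLevel k then -1 else 0

theorem hierDiff_apply_fourier (m : ℕ) (k : ℤ) :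
    (hierDiff m).apply (fun x => (fourier k x : ℂ)) = hierSymbol m k := by
  cases m with
  | zero =>
    rw [hierDiff, trapezoid_apply_fourier one_pos]
    simp [hierSymbol]
  | succ m =>
    rw [hierDiff, applyHom_eq, map_sub, ← applyHom_eq, ← applyHom_eq,
      trapezoid_apply_fourier (by positivity), trapezoid_apply_fourier (by positivity)]
    have h : ∀ n : ℕ, ((2 ^ n : ℕ) : ℤ) ∣ k ↔ k = 0 ∨ n ≤ padicValInt 2 k := by
      intro n
      have := padicValInt_dvd_iff (p := 2) n k
      exact_mod_cast this
    simp only [h, hierSymbol, freqLevel, Nat.succ_ne_zero, if_false]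
    by_cases hk : k = 0
    · simp [hk]
    · simp only [hk, false_or, if_false, add_left_inj]
      rcases lt_trichotomy m (padicValInt 2 k) with h | h | h
      · rw [if_pos (Nat.succ_le_of_lt h), if_pos h.le, if_neg h.ne, sub_self]
      · rw [if_neg (by omega), if_pos h.le, if_pos h, zero_sub]
      · rw [if_neg (by omega), if_neg (by omega), if_neg h.ne', sub_self]

theorem tensorRule_apply_mFourier {d : ℕ} (q : Fin d → CubatureRule UnitAddCircle)
    (k : Fin d → ℤ) :
    (tensorRule q).apply (fun x => UnitAddTorus.mFourier k x) =
      ∏ j, (q j).apply (fun x => (fourier (k j) x : ℂ)) := by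
  rw [CubatureRule.apply, tensorRule, Finsupp.onFinset_sum _ (by simp)]
  simp only [CubatureRule.apply, Finsupp.sum]
  rw [Finset.prod_univ_sum]
  refine Finset.sum_congr rfl fun x _ => ?_
  rw [Finset.prod_mul_distrib]
  push_cast
  rfl

theorem sparseGridRule_apply_mFourier (d L : ℕ) (k : Fin d → ℤ) :
    (sparseGridRule d L).apply (fun x => UnitAddTorus.mFourier k x) =
      ∑ m ∈ levels d L, ∏ j, hierSymbol (m j) (k j) := by
  rw [applyHom_eq, sparseGridRule, map_sum]
  refine Finset.sum_congr rfl fun m _ => ?_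
  rw [← applyHom_eq, tensorRule_apply_mFourier]
  simp only [hierDiff_apply_fourier]

theorem sum_range_hierSymbol {n : ℕ} {k : ℤ} (h : freqLevel k ≤ n) :
    ∑ m ∈ Finset.range (n + 1), hierSymbol m k = if k = 0 then 1 else 0 := by
  rw [Finset.sum_range_succ']
  simp only [hierSymbol, Nat.succ_ne_zero, if_false, if_true]
  rcases hu : freqLevel k with _ | u
  · simp [freqLevel_eq_zero.mp hu]
  · have hk : k ≠ 0 := fun h0 => by simp [freqLevel_eq_zero.mpr h0] at hu
    have : u < n := by omega
    simp [hk, Finset.sum_ite_eq', this]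

theorem sum_piFinset_hierSymbol {d n : ℕ} {k : Fin d → ℤ} (h : ∀ j, freqLevel (k j) ≤ n) :
    ∑ m ∈ Fintype.piFinset fun _ : Fin d => Finset.range (n + 1), ∏ j, hierSymbol (m j) (k j) =
      if k = 0 then 1 else 0 := by
  rw [← Finset.prod_univ_sum (fun _ : Fin d => Finset.range (n + 1))
    (fun j m => hierSymbol m (k j))]
  simp only [fun j => sum_range_hierSymbol (h j)]
  split_ifs with hk
  · simp [hk]
  · obtain ⟨j, hj⟩ := Function.ne_iff.mp hk
    exact Finset.prod_eq_zero (Finset.mem_univ j) (if_neg hj)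

theorem le_freqLevel_of_prod_ne_zero {d : ℕ} {m : Fin d → ℕ} {k : Fin d → ℤ}
    (h : ∏ j, hierSymbol (m j) (k j) ≠ 0) (j : Fin d) : m j = 0 ∨ m j = freqLevel (k j) := by
  have := Finset.prod_ne_zero_iff.mp h j (Finset.mem_univ j)
  unfold hierSymbol at this
  split_ifs at this with h0 h1
  · exact Or.inl h0
  · exact Or.inr h1
  · exact absurd rfl this

/-- The error of the sparse grid rule at the character of frequency `k`. -/
def charError (d L : ℕ) (k : Fin d → ℤ) : ℂ :=
  (if k = 0 then 1 else 0) - (sparseGridRule d L).apply (fun x => UnitAddTorus.mFourier k x)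

/-- Every nonzero term of the full tensor sum has `m j ≤ freqLevel (k j)` for all `j`, so the
truncation drops only zeros. -/
theorem charError_eq_zero {d L : ℕ} {k : Fin d → ℤ} (h : ∑ j, freqLevel (k j) ≤ L) :
    charError d L k = 0 := by
  have hj : ∀ j, freqLevel (k j) ≤ L := fun j =>
    (Finset.single_le_sum (f := fun j => freqLevel (k j)) (fun i _ => Nat.zero_le _)
      (Finset.mem_univ j)).trans h
  rw [charError, sparseGridRule_apply_mFourier, ← sum_piFinset_hierSymbol hj, sub_eq_zero]
  refine (Finset.sum_subset (Finset.filter_subset _ _) fun m hm hm' => ?_).symm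
  by_contra hne
  refine hm' (Finset.mem_filter.mpr ⟨hm, le_trans (Finset.sum_le_sum fun j _ => ?_) h⟩)
  rcases le_freqLevel_of_prod_ne_zero hne j with h | h <;> omega

/-- Among the nonzero terms, only the top tuple `m j = freqLevel (k j)` exceeds total level `L`; the
error is this single missing term. -/
theorem charError_of_sum_eq {d L : ℕ} {k : Fin d → ℤ} (h : ∑ j, freqLevel (k j) = L + 1) :
    charError d L k = ∏ j, hierSymbol (freqLevel (k j)) (k j) := by
  have hj : ∀ j, freqLevel (k j) ≤ L + 1 := fun j =>
    (Finset.single_le_sum (f := fun j => freqLevel (k j)) (fun i _ => Nat.zero_le _)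
      (Finset.mem_univ j)).trans h.le
  have hmem : (fun j => freqLevel (k j)) ∈
      (Fintype.piFinset fun _ : Fin d => Finset.range (L + 1 + 1)) := by
    simpa [Nat.lt_succ_iff] using hj
  rw [charError, sparseGridRule_apply_mFourier, ← sum_piFinset_hierSymbol hj,
    ← Finset.add_sum_erase _ _ hmem, add_sub_assoc, add_eq_left, sub_eq_zero]
  refine (Finset.sum_subset ?_ fun m hm hm' => ?_).symm
  · intro m hm
    obtain ⟨hm1, hm2⟩ := Finset.mem_filter.mp hm
    refine Finset.mem_erase.mpr ⟨?_, ?_⟩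
    · rintro rfl
      have : ∑ j, freqLevel (k j) ≤ L := hm2
      omega
    · rw [Fintype.mem_piFinset] at hm1 ⊢
      intro j
      have := Finset.mem_range.mp (hm1 j)
      exact Finset.mem_range.mpr (by omega)
  · by_contra hne
    have hle : ∀ j, m j ≤ freqLevel (k j) := fun j => by
      rcases le_freqLevel_of_prod_ne_zero hne j with h | h <;> omega
    obtain ⟨hm1, -⟩ := Finset.mem_erase.mp hm
    have hlt : ∑ j, m j < ∑ j, freqLevel (k j) := by
      refine Finset.sum_lt_sum (fun j _ => hle j) ?_
      obtain ⟨j, hj⟩ := Function.ne_iff.mp hm1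
      exact ⟨j, Finset.mem_univ j, lt_of_le_of_ne (hle j) hj⟩
    have hs : ∑ j, m j ≤ L := by omega
    refine hm' (Finset.mem_filter.mpr ⟨?_, hs⟩)
    rw [Fintype.mem_piFinset]
    intro j
    have := Finset.single_le_sum (f := m) (fun i _ => Nat.zero_le _) (Finset.mem_univ j)
    exact Finset.mem_range.mpr (by omega)

theorem norm_charError_le (d L : ℕ) (k : Fin d → ℤ) : ‖charError d L k‖ ≤ 1 + 2 ^ d := by
  have h1 : ‖(if k = 0 then 1 else 0 : ℂ)‖ ≤ 1 := by split_ifs <;> simp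
  have h3 : ∀ (n : ℕ) (l : ℤ), ∑ m ∈ Finset.range (n + 1), ‖hierSymbol m l‖ ≤ 2 := by
    intro n l
    rw [Finset.sum_range_succ']
    -- If `freqLevel l = 0`, truncated subtraction puts the indicator at `m = 0`, which only weakens
    -- the bound.
    have : ∀ m ∈ Finset.range n, ‖hierSymbol (m + 1) l‖ ≤
        if m = freqLevel l - 1 then 1 else 0 := by
      intro m _
      by_cases h : m + 1 = freqLevel l
      · simp [hierSymbol, ← h]
      · rw [hierSymbol, if_neg m.succ_ne_zero, if_neg h, norm_zero]
        split_ifs <;> simp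
    calc _ ≤ ∑ m ∈ Finset.range n, (if m = freqLevel l - 1 then (1 : ℝ) else 0) +
          ‖hierSymbol 0 l‖ := by gcongr with m hm; exact this m hm
      _ ≤ 1 + 1 := by
        gcongr
        · rw [Finset.sum_ite_eq']; split_ifs <;> simp
        · simp [hierSymbol]
      _ = 2 := by norm_num
  have h2 : ‖(sparseGridRule d L).apply (fun x => UnitAddTorus.mFourier k x)‖ ≤ 2 ^ d := by
    rw [sparseGridRule_apply_mFourier]
    calc _ ≤ ∑ m ∈ levels d L, ∏ j, ‖hierSymbol (m j) (k j)‖ := by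
          refine (norm_sum_le _ _).trans_eq ?_
          simp only [norm_prod]
      _ ≤ ∑ m ∈ Fintype.piFinset fun _ : Fin d => Finset.range (L + 1),
          ∏ j, ‖hierSymbol (m j) (k j)‖ :=
        Finset.sum_le_sum_of_subset_of_nonneg (Finset.filter_subset _ _)
          fun m _ _ => Finset.prod_nonneg fun j _ => norm_nonneg _
      _ = ∏ j, ∑ m ∈ Finset.range (L + 1), ‖hierSymbol m (k j)‖ :=
        (Finset.prod_univ_sum (fun _ : Fin d => Finset.range (L + 1))
          (fun j m => ‖hierSymbol m (k j)‖)).symm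
      _ ≤ ∏ _j : Fin d, 2 := Finset.prod_le_prod
        (fun j _ => Finset.sum_nonneg fun _ _ => norm_nonneg _) fun j _ => h3 L (k j)
      _ = 2 ^ d := by simp
  exact (norm_sub_le _ _).trans (add_le_add h1 h2)

/-! ### Tails of the series of inverse weights -/

/-- The inverse weight of a univariate frequency. -/
def invWeight (r : ℕ) (k : ℤ) : ℝ≥0∞ :=
  ENNReal.ofReal (1 + |2 * Real.pi * (k : ℝ)| ^ (2 * r))⁻¹

theorem invWeight_le_one (r : ℕ) (k : ℤ) : invWeight r k ≤ 1 := by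
  rw [invWeight, ENNReal.ofReal_le_one]
  exact inv_le_one_of_one_le₀ (by simp only [le_add_iff_nonneg_right]; positivity)

theorem ofReal_inv_mixWeight {d : ℕ} (r : ℕ) (k : Fin d → ℤ) :
    ENNReal.ofReal (mixWeight r k)⁻¹ = ∏ j, invWeight r (k j) := by
  rw [mixWeight, ← Finset.prod_inv_distrib, ENNReal.ofReal_prod_of_nonneg fun _ _ => by positivity]
  rfl

/-- The ratio `4^(-r)` between the sums of the inverse weights on consecutive levels. -/
def ratio (r : ℕ) : ℝ≥0∞ := ENNReal.ofReal ((1 / 4) ^ r)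

theorem ratio_le_quarter {r : ℕ} (hr : 1 ≤ r) : ratio r ≤ ENNReal.ofReal (1 / 4) :=
  ENNReal.ofReal_le_ofReal (pow_le_of_le_one (by norm_num) (by norm_num) (by omega))

theorem tsum_ratio_pow_le {r : ℕ} (hr : 1 ≤ r) : ∑' n, ratio r ^ n ≤ 2 := by
  calc ∑' n, ratio r ^ n ≤ ∑' n, (2⁻¹ : ℝ≥0∞) ^ n := by
        refine ENNReal.tsum_le_tsum fun n => ?_
        gcongr
        refine (ratio_le_quarter hr).trans ?_
        rw [← ENNReal.ofReal_ofNat, ← ENNReal.ofReal_inv_of_pos two_pos]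
        exact ENNReal.ofReal_le_ofReal (by norm_num)
    _ = 2 := ENNReal.tsum_geometric_two

theorem invWeight_mul_le (r u : ℕ) (m : ℤ) (hm : m ≠ 0) (hr : 1 ≤ r) :
    invWeight r (2 ^ u * m) ≤ ratio r ^ u * ENNReal.ofReal (1 / (m : ℝ) ^ 2) := by
  rw [invWeight, ratio, ← ENNReal.ofReal_pow (by positivity),
    ← ENNReal.ofReal_mul (by positivity)]
  refine ENNReal.ofReal_le_ofReal ?_
  have hm' : (1 : ℝ) ≤ |(m : ℝ)| := by exact_mod_cast Int.one_le_abs hm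
  have hpos : (0 : ℝ) < (4 ^ r) ^ u * (m : ℝ) ^ 2 := by positivity
  have h : ((4 : ℝ) ^ r) ^ u * (m : ℝ) ^ 2 ≤
      1 + |2 * Real.pi * ((2 ^ u * m : ℤ) : ℝ)| ^ (2 * r) := by
    have e : ((4 : ℝ) ^ r) ^ u = (2 ^ u) ^ (2 * r) := by
      rw [show (4 : ℝ) = 2 ^ 2 by norm_num, ← pow_mul, ← pow_mul, ← pow_mul]
      congr 1
      ring
    calc ((4 : ℝ) ^ r) ^ u * (m : ℝ) ^ 2 = (2 ^ u) ^ (2 * r) * |(m : ℝ)| ^ 2 := by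
          rw [e, sq_abs]
      _ ≤ (2 ^ u) ^ (2 * r) * |(m : ℝ)| ^ (2 * r) := by
          exact mul_le_mul_of_nonneg_left (pow_le_pow_right₀ hm' (by omega)) (by positivity)
      _ = (1 * (2 ^ u * |(m : ℝ)|)) ^ (2 * r) := by rw [one_mul, mul_pow]
      _ ≤ |2 * Real.pi * ((2 ^ u * m : ℤ) : ℝ)| ^ (2 * r) := by
          push_cast
          rw [abs_mul (2 * Real.pi), abs_mul, abs_mul, abs_of_pos Real.pi_pos,
            abs_of_pos (by positivity : (0 : ℝ) < 2 ^ u), abs_two]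
          refine pow_le_pow_left₀ (by positivity) ?_ _
          gcongr
          linarith [Real.pi_gt_three]
      _ ≤ _ := by linarith
  calc _ ≤ (((4 : ℝ) ^ r) ^ u * (m : ℝ) ^ 2)⁻¹ := inv_anti₀ hpos h
    _ = _ := by rw [mul_inv, one_div, inv_pow, inv_pow, one_div]

/-- Frequencies of level `u + 1` are odd multiples of `2^u`; oddness is dropped, and the sum over
all nonzero multiples converges like `∑ 1 / m²`. -/
theorem exists_tsum_invWeight_le {r : ℕ} (hr : 1 ≤ r) : ∃ C : ℝ≥0∞, C ≠ ∞ ∧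
    ∀ u, ∑' k, (if freqLevel k = u then invWeight r k else 0) ≤ C * ratio r ^ u := by
  set S : ℝ≥0∞ := ∑' m : ℤ, ENNReal.ofReal (1 / (m : ℝ) ^ 2) with hS
  have hSt : S ≠ ∞ := by
    have := (Real.summable_one_div_int_pow (p := 2)).mpr (by norm_num)
    exact this.tsum_ofReal_ne_top
  have hr0 : ratio r ≠ 0 := by
    rw [ratio, Ne, ENNReal.ofReal_eq_zero, not_le]; positivity
  have hrt : ratio r ≠ ∞ := ENNReal.ofReal_ne_top
  -- The `1` covers level `0`, which contains only `k = 0`; the inverse ratio pays for level `u + 1`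
  -- yielding only the factor `2^u`.
  refine ⟨1 + S * (ratio r)⁻¹, by finiteness, fun u => ?_⟩
  cases u with
  | zero =>
    rw [tsum_eq_single 0 fun k hk => if_neg fun h => hk (freqLevel_eq_zero.mp h)]
    simp only [freqLevel_eq_zero.mpr rfl, if_true, pow_zero, mul_one]
    exact (invWeight_le_one r 0).trans le_self_add
  | succ u =>
    have hinj : Function.Injective fun m : ℤ => 2 ^ u * m := fun a b h =>
      mul_left_cancel₀ (by positivity) h
    rw [← hinj.tsum_eq]
    · calc ∑' m : ℤ, (if freqLevel (2 ^ u * m) = u + 1 then invWeight r (2 ^ u * m) else 0)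
          ≤ ∑' m : ℤ, ratio r ^ u * ENNReal.ofReal (1 / (m : ℝ) ^ 2) := by
            refine ENNReal.tsum_le_tsum fun m => ?_
            split_ifs with h
            · refine invWeight_mul_le r u m ?_ hr
              rintro rfl
              simp [freqLevel] at h
            · exact zero_le
        _ = ratio r ^ u * S := ENNReal.tsum_mul_left
        _ = S * (ratio r)⁻¹ * ratio r ^ (u + 1) := by
            rw [pow_succ', mul_assoc, ← mul_assoc (ratio r)⁻¹, ENNReal.inv_mul_cancel hr0 hrt,
              one_mul, mul_comm]
        _ ≤ _ := by gcongr; exact le_add_self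
    · intro k hk
      rw [Function.mem_support, ite_ne_right_iff] at hk
      have hu := hk.1
      have : (2 : ℤ) ^ u ∣ k := by
        have := (padicValInt_dvd_iff (p := 2) u k).mpr
        push_cast at this
        refine this ?_
        unfold freqLevel at hu
        split_ifs at hu
        exact Or.inr (by omega)
      obtain ⟨m, rfl⟩ := this
      exact ⟨m, rfl⟩

/-- The sum of the inverse weights of the frequencies of total level at least `n`. -/
def weightTail (r d n : ℕ) : ℝ≥0∞ :=
  ∑' k : Fin d → ℤ, if n ≤ ∑ j, freqLevel (k j) then ∏ j, invWeight r (k j) else 0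

/-- The first coordinate is split off and grouped by its level. For `u ≥ n` the truncated `n - u =
0` correctly leaves no constraint on the rest. -/
theorem weightTail_succ (r d n : ℕ) : weightTail r (d + 1) n =
    ∑' u, (∑' k, if freqLevel k = u then invWeight r k else 0) * weightTail r d (n - u) := by
  calc weightTail r (d + 1) n
      = ∑' k₀ : ℤ, invWeight r k₀ * weightTail r d (n - freqLevel k₀) := by
        rw [weightTail, ← (Fin.consEquiv fun _ : Fin (d + 1) => ℤ).tsum_eq, ENNReal.tsum_prod']
        refine tsum_congr fun k₀ => ?_
        rw [weightTail, ← ENNReal.tsum_mul_left]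
        refine tsum_congr fun k => ?_
        simp only [Fin.consEquiv_apply, Fin.sum_univ_succ, Fin.prod_univ_succ, Fin.cons_zero,
          Fin.cons_succ, mul_ite, mul_zero]
        exact if_congr tsub_le_iff_left.symm rfl rfl
    _ = ∑' k₀ : ℤ, ∑' u, (if freqLevel k₀ = u then invWeight r k₀ else 0) *
          weightTail r d (n - u) := by
        refine tsum_congr fun k₀ => ?_
        rw [tsum_eq_single (freqLevel k₀) fun u hu => by rw [if_neg hu.symm, zero_mul], if_pos rfl]
    _ = _ := by
        rw [ENNReal.tsum_comm]
        exact tsum_congr fun u => ENNReal.tsum_mul_right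

/-- Induction on the dimension. For first level `u < n` the factors `ratio^u` and `ratio^(n-u)`
combine to `ratio^n`, so these `n` terms yield one more power of `n + 1`; the levels `u ≥ n` form a
geometric tail. -/
theorem exists_weightTail_le {r : ℕ} (hr : 1 ≤ r) (m : ℕ) : ∃ C : ℝ≥0∞, C ≠ ∞ ∧
    ∀ n, weightTail r (m + 1) n ≤ C * ((n : ℝ≥0∞) + 1) ^ m * ratio r ^ n := by
  obtain ⟨A, hA, hAu⟩ := exists_tsum_invWeight_le hr
  have hgeom : ∀ n, ∑' u, ratio r ^ (u + n) ≤ 2 * ratio r ^ n := fun n => by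
    simp only [pow_add, ENNReal.tsum_mul_right]
    gcongr
    exact tsum_ratio_pow_le hr
  induction m with
  | zero =>
    refine ⟨A * 2, by finiteness, fun n => ?_⟩
    have h0 : ∀ n, weightTail r 0 n = if n ≤ 0 then 1 else 0 := fun n => by
      rw [weightTail, tsum_fintype]; simp
    rw [weightTail_succ]
    simp only [h0, pow_zero, mul_one]
    calc _ ≤ ∑' u, (if n ≤ u then A * ratio r ^ u else 0) := by
          refine ENNReal.tsum_le_tsum fun u => ?_
          by_cases h : n ≤ u
          · rw [if_pos (by omega), if_pos h, mul_one]; exact hAu u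
          · rw [if_neg (by omega), if_neg h, mul_zero]
      _ = ∑' u, A * ratio r ^ (u + n) := by
          rw [← (add_left_injective n).tsum_eq]
          · simp
          · intro u hu
            rw [Function.mem_support, ite_ne_right_iff] at hu
            exact ⟨u - n, Nat.sub_add_cancel hu.1⟩
      _ ≤ _ := by
          rw [ENNReal.tsum_mul_left, mul_assoc]
          gcongr
          exact hgeom n
  | succ m ih =>
    obtain ⟨B, hB, hBn⟩ := ih
    -- `3 = 1 + 2`: one from the levels below `n`, two from the geometric tail.
    refine ⟨A * B * 3, by finiteness, fun n => ?_⟩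
    rw [weightTail_succ, ← ENNReal.summable.sum_add_tsum_nat_add' (k := n)]
    have h1 : ∑ u ∈ Finset.range n, (∑' k, if freqLevel k = u then invWeight r k else 0) *
        weightTail r (m + 1) (n - u) ≤ A * B * ((n : ℝ≥0∞) + 1) ^ (m + 1) * ratio r ^ n := by
      calc _ ≤ ∑ u ∈ Finset.range n, A * B * ((n : ℝ≥0∞) + 1) ^ m * ratio r ^ n := by
            refine Finset.sum_le_sum fun u hu => ?_
            have hu' := (Finset.mem_range.mp hu).le
            calc _ ≤ (A * ratio r ^ u) * (B * (((n - u : ℕ) : ℝ≥0∞) + 1) ^ m * ratio r ^ (n - u)) :=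
                  mul_le_mul' (hAu u) (hBn _)
              _ = A * B * (((n - u : ℕ) : ℝ≥0∞) + 1) ^ m * (ratio r ^ u * ratio r ^ (n - u)) := by
                  ring
              _ = A * B * (((n - u : ℕ) : ℝ≥0∞) + 1) ^ m * ratio r ^ n := by
                  rw [← pow_add, Nat.add_sub_cancel' hu']
              _ ≤ _ := by gcongr; omega
        _ = n * (A * B * ((n : ℝ≥0∞) + 1) ^ m * ratio r ^ n) := by simp
        _ ≤ ((n : ℝ≥0∞) + 1) * (A * B * ((n : ℝ≥0∞) + 1) ^ m * ratio r ^ n) := by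
            gcongr; exact le_self_add
        _ = _ := by ring
    have h2 : ∑' u, (∑' k, if freqLevel k = u + n then invWeight r k else 0) *
        weightTail r (m + 1) (n - (u + n)) ≤ A * B * 2 * ((n : ℝ≥0∞) + 1) ^ (m + 1) * ratio r ^ n := by
      calc _ ≤ ∑' u, A * ratio r ^ (u + n) * B := by
            refine ENNReal.tsum_le_tsum fun u => mul_le_mul' (hAu _) ?_
            rw [show n - (u + n) = 0 by omega]
            simpa using hBn 0
        _ = A * B * ∑' u, ratio r ^ (u + n) := by
            rw [ENNReal.tsum_mul_right, ENNReal.tsum_mul_left]; ring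
        _ ≤ A * B * (2 * (((n : ℝ≥0∞) + 1) ^ (m + 1) * ratio r ^ n)) := by
            gcongr
            refine (hgeom n).trans ?_
            gcongr
            exact le_mul_of_one_le_left' (one_le_pow₀ le_add_self)
        _ = _ := by ring
    calc _ ≤ _ := add_le_add h1 h2
      _ = _ := by ring

theorem weightTail_ne_top {r : ℕ} (hr : 1 ≤ r) (m n : ℕ) : weightTail r (m + 1) n ≠ ∞ := by
  obtain ⟨C, hC, h⟩ := exists_weightTail_le hr m
  refine ne_top_of_le_ne_top ?_ (h n)
  have : ratio r ≠ ∞ := ENNReal.ofReal_ne_top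
  finiteness

/-! ### Integrals and Fourier coefficients on the torus -/

instance (d : ℕ) : IsProbabilityMeasure (torusMeasure d) := by
  unfold torusMeasure; infer_instance

theorem integrable_of_continuous {E : Type*} [NormedAddCommGroup E] {d : ℕ}
    {f : UnitAddTorus (Fin d) → E} (hf : Continuous f) : Integrable f (torusMeasure d) :=
  hf.integrable_of_hasCompactSupport (HasCompactSupport.of_compactSpace f)

theorem integral_mFourier {d : ℕ} (k : Fin d → ℤ) :
    ∫ x, UnitAddTorus.mFourier k x ∂torusMeasure d = if k = 0 then 1 else 0 := by
  have h := orthonormal_iff_ite.mp (UnitAddTorus.orthonormal_mFourier (d := Fin d)) 0 k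
  simp only [ContinuousMap.inner_toLp, UnitAddTorus.mFourier_zero, ContinuousMap.one_apply,
    map_one, mul_one, eq_comm (a := (0 : Fin d → ℤ))] at h
  exact h

theorem torusFourierCoeff_eq {𝕜 : Type*} [RCLike 𝕜] {d : ℕ} (f : UnitAddTorus (Fin d) → 𝕜)
    (k : Fin d → ℤ) : torusFourierCoeff f k =
      ∫ x, UnitAddTorus.mFourier (-k) x * RCLike.map 𝕜 ℂ (f x) ∂torusMeasure d := rfl

theorem norm_rclikeMap {𝕜 : Type*} [RCLike 𝕜] (z : 𝕜) : ‖RCLike.map 𝕜 ℂ z‖ = ‖z‖ := by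
  rw [← sq_eq_sq₀ (norm_nonneg _) (norm_nonneg _), RCLike.norm_sq_eq_def, RCLike.norm_sq_eq_def]
  simp

theorem rclikeMap_ofReal {𝕜 : Type*} [RCLike 𝕜] (y : ℝ) :
    RCLike.map 𝕜 ℂ (y : 𝕜) = (y : ℂ) := by
  simp

theorem apply_rclikeMap {X 𝕜 : Type*} [RCLike 𝕜] (Q : CubatureRule X) (f : X → 𝕜) :
    Q.apply (fun x => RCLike.map 𝕜 ℂ (f x)) = RCLike.map 𝕜 ℂ (Q.apply f) := by
  simp only [CubatureRule.apply, Finsupp.sum, map_sum]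
  refine Finset.sum_congr rfl fun x _ => ?_
  rw [← RCLike.real_smul_eq_coe_mul, ← RCLike.real_smul_eq_coe_mul, map_smul]

theorem torusIntegral_rclikeMap {𝕜 : Type*} [RCLike 𝕜] {d : ℕ} {f : UnitAddTorus (Fin d) → 𝕜}
    (hf : Continuous f) :
    torusIntegral (fun x => RCLike.map 𝕜 ℂ (f x)) = RCLike.map 𝕜 ℂ (torusIntegral f) :=
  (RCLike.map 𝕜 ℂ).integral_comp_comm (integrable_of_continuous hf)

/-! ### The upper bound by duality -/

theorem tsum_enorm_mul_le {ι : Type*} {w : ι → ℝ} (hw : ∀ i, 0 < w i) (a b : ι → ℂ) :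
    ∑' i, ‖a i‖ₑ * ‖b i‖ₑ ≤ (∑' i, ENNReal.ofReal (w i * ‖a i‖ ^ 2)) ^ (1 / 2 : ℝ) *
      (∑' i, ENNReal.ofReal ((w i)⁻¹ * ‖b i‖ ^ 2)) ^ (1 / 2 : ℝ) := by
  -- Hölder's inequality for counting measure; with the top σ-algebra every function is measurable.
  let _ : MeasurableSpace ι := ⊤
  have h := ENNReal.lintegral_mul_le_Lp_mul_Lq (Measure.count : Measure ι)
    Real.HolderConjugate.two_two
    (f := fun i => ENNReal.ofReal (Real.sqrt (w i) * ‖a i‖))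
    (g := fun i => ENNReal.ofReal ((Real.sqrt (w i))⁻¹ * ‖b i‖))
    measurable_from_top.aemeasurable measurable_from_top.aemeasurable
  simp only [lintegral_count, Pi.mul_apply] at h
  have h1 : ∀ i, ENNReal.ofReal (Real.sqrt (w i) * ‖a i‖) *
      ENNReal.ofReal ((Real.sqrt (w i))⁻¹ * ‖b i‖) = ‖a i‖ₑ * ‖b i‖ₑ := fun i => by
    have : 0 < Real.sqrt (w i) := Real.sqrt_pos.mpr (hw i)
    rw [← ENNReal.ofReal_mul (by positivity), ← ofReal_norm, ← ofReal_norm,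
      ← ENNReal.ofReal_mul (by positivity)]
    congr 1
    field_simp
  have h2 : ∀ i, ENNReal.ofReal (Real.sqrt (w i) * ‖a i‖) ^ (2 : ℝ) =
      ENNReal.ofReal (w i * ‖a i‖ ^ 2) := fun i => by
    rw [ENNReal.rpow_two, ← ENNReal.ofReal_pow (by positivity), mul_pow,
      Real.sq_sqrt (hw i).le]
  have h3 : ∀ i, ENNReal.ofReal ((Real.sqrt (w i))⁻¹ * ‖b i‖) ^ (2 : ℝ) =
      ENNReal.ofReal ((w i)⁻¹ * ‖b i‖ ^ 2) := fun i => by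
    rw [ENNReal.rpow_two, ← ENNReal.ofReal_pow (by positivity), mul_pow, inv_pow,
      Real.sq_sqrt (hw i).le]
  simpa only [h1, h2, h3] using h

theorem mixWeight_pos {d : ℕ} (r : ℕ) (k : Fin d → ℤ) : 0 < mixWeight r k :=
  Finset.prod_pos fun _ _ => by positivity

/-- Summable coefficients make the Fourier series of a continuous function converge to it at every
point, so a rule with finitely many nodes acts term by term. -/
theorem hasSum_torusFourierCoeff_mul_charError {𝕜 : Type*} [RCLike 𝕜] {d : ℕ}
    {f : UnitAddTorus (Fin d) → 𝕜} (hf : Continuous f)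
    (hs : Summable (torusFourierCoeff f)) (L : ℕ) :
    HasSum (fun k => torusFourierCoeff f k * charError d L k)
      (RCLike.map 𝕜 ℂ (torusIntegral f - (sparseGridRule d L).apply f)) := by
  let g : UnitAddTorus (Fin d) → ℂ := fun x => RCLike.map 𝕜 ℂ (f x)
  have hg : ∀ x, HasSum (fun k => torusFourierCoeff f k * UnitAddTorus.mFourier k x) (g x) :=
    UnitAddTorus.hasSum_mFourier_series_apply_of_summable (f := ⟨g, by fun_prop⟩) hs
  have hQ : HasSum (fun k => torusFourierCoeff f k *
      (sparseGridRule d L).apply (fun x => UnitAddTorus.mFourier k x))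
      ((sparseGridRule d L).apply g) := by
    generalize sparseGridRule d L = Q
    have := hasSum_sum fun x (_ : x ∈ Q.support) => (hg x).mul_left ((Q x : ℝ) : ℂ)
    refine this.congr_fun fun k => ?_
    rw [CubatureRule.apply, Finsupp.sum, Finset.mul_sum]
    exact Finset.sum_congr rfl fun x _ => mul_left_comm _ _ _
  have hI : HasSum (fun k => torusFourierCoeff f k * (if k = 0 then 1 else 0))
      (torusIntegral g) := by
    have h0 : torusIntegral g = torusFourierCoeff f 0 := by
      simp only [torusFourierCoeff_eq, torusIntegral, neg_zero, UnitAddTorus.mFourier_zero,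
        ContinuousMap.one_apply, one_mul, g]
    rw [h0]
    refine (hasSum_ite_eq (0 : Fin d → ℤ) (torusFourierCoeff f 0)).congr_fun fun k => ?_
    split_ifs with hk
    · rw [hk, mul_one]
    · rw [mul_zero]
  have hmap : RCLike.map 𝕜 ℂ (torusIntegral f - (sparseGridRule d L).apply f) =
      torusIntegral g - (sparseGridRule d L).apply g := by
    rw [map_sub, ← torusIntegral_rclikeMap hf, ← apply_rclikeMap]
  rw [hmap]
  refine (hI.sub hQ).congr_fun fun k => ?_
  rw [charError, mul_sub]

/-- Cauchy-Schwarz is used twice: against the constant `1` for summability of the coefficients, then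
against `charError` for the bound. -/
theorem enorm_error_le {𝕜 : Type*} [RCLike 𝕜] {m r : ℕ} (hr : 1 ≤ r)
    {f : UnitAddTorus (Fin (m + 1)) → 𝕜} (hf : f ∈ mixSpace 𝕜 (m + 1) r) (h1 : mixNorm r f ≤ 1)
    (L : ℕ) : ‖torusIntegral f - (sparseGridRule (m + 1) L).apply f‖ₑ ≤
      (∑' k, ENNReal.ofReal ((mixWeight r k)⁻¹ * ‖charError (m + 1) L k‖ ^ 2)) ^ (1 / 2 : ℝ) := by
  have hs : Summable (torusFourierCoeff f) := by
    have h := tsum_enorm_mul_le (mixWeight_pos (d := m + 1) r) (torusFourierCoeff f) fun _ => 1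
    have ht : ∑' k : Fin (m + 1) → ℤ, ENNReal.ofReal (mixWeight r k)⁻¹ ≠ ∞ := by
      have := weightTail_ne_top hr m 0
      simpa only [weightTail, zero_le, if_true, ← ofReal_inv_mixWeight] using this
    simp only [enorm_one, norm_one, one_pow, mul_one] at h
    have h2 : ∑' k, ‖torusFourierCoeff f k‖ₑ ≠ ∞ := by
      refine ne_top_of_le_ne_top (ENNReal.mul_ne_top hf.2.ne ?_) h
      exact ENNReal.rpow_ne_top_of_nonneg (by norm_num) ht
    exact Summable.of_enorm h2
  have hsum := hasSum_torusFourierCoeff_mul_charError hf.1 hs L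
  rw [← ofReal_norm, ← norm_rclikeMap, ofReal_norm, ← hsum.tsum_eq]
  calc _ ≤ ∑' k, ‖torusFourierCoeff f k‖ₑ * ‖charError (m + 1) L k‖ₑ := by
        refine enorm_tsum_le_tsum_enorm.trans_eq ?_
        simp only [enorm_mul]
    _ ≤ _ := tsum_enorm_mul_le (mixWeight_pos (d := m + 1) r) _ _
    _ ≤ _ := mul_le_of_le_one_left' h1

theorem worstCaseError_le (𝕜 : Type*) [RCLike 𝕜] {r : ℕ} (hr : 1 ≤ r) (m L : ℕ) :
    worstCaseError 𝕜 r (sparseGridRule (m + 1) L) ≤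
      (ENNReal.ofReal ((1 + 2 ^ (m + 1)) ^ 2) * weightTail r (m + 1) (L + 1)) ^ (1 / 2 : ℝ) := by
  refine iSup₂_le fun f hf => (enorm_error_le hr hf.1 hf.2 L).trans ?_
  gcongr
  rw [weightTail, ← ENNReal.tsum_mul_left]
  refine ENNReal.tsum_le_tsum fun k => ?_
  split_ifs with h
  · rw [← ofReal_inv_mixWeight, ← ENNReal.ofReal_mul (by positivity), mul_comm]
    refine ENNReal.ofReal_le_ofReal (mul_le_mul_of_nonneg_right ?_ (inv_nonneg.mpr (mixWeight_pos r k).le))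
    exact pow_le_pow_left₀ (norm_nonneg _) (norm_charError_le _ _ _) 2
  · rw [charError_eq_zero (by omega)]
    simp

/-! ### The lower bound by a fooling function -/

theorem freqLevel_neg (k : ℤ) : freqLevel (-k) = freqLevel k := by
  simp [freqLevel, padicValInt]

/-- A frequency of level `u`. -/
def levelFreq (u : ℕ) : ℤ := if u = 0 then 0 else 2 ^ (u - 1)

theorem freqLevel_levelFreq (u : ℕ) : freqLevel (levelFreq u) = u := by
  cases u with
  | zero => simp [levelFreq, freqLevel]
  | succ u =>
    rw [levelFreq, if_neg u.succ_ne_zero, freqLevel, if_neg (by positivity), Nat.add_sub_cancel]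
    have : (2 : ℤ) ^ u = ((2 ^ u : ℕ) : ℤ) := by push_cast; rfl
    rw [this, padicValInt.of_nat, padicValNat.prime_pow]

theorem charError_eq_sign {d L : ℕ} {k : Fin d → ℤ} {u : Fin d → ℕ}
    (hu : ∀ j, freqLevel (k j) = u j) (h : ∑ j, u j = L + 1) :
    charError d L k = ((∏ j, if u j = 0 then 1 else -1 : ℝ) : ℂ) := by
  rw [charError_of_sum_eq (by simpa only [hu] using h)]
  push_cast
  refine Finset.prod_congr rfl fun j _ => ?_
  rw [hierSymbol, if_pos rfl, hu j]
  split_ifs <;> simp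

theorem mixWeight_neg {d : ℕ} (r : ℕ) (k : Fin d → ℤ) : mixWeight r (-k) = mixWeight r k := by
  simp only [mixWeight, Pi.neg_apply, Int.cast_neg, mul_neg, abs_neg]

theorem mixWeight_levelFreq_le {d : ℕ} (r : ℕ) (u : Fin d → ℕ) :
    mixWeight r (fun j => levelFreq (u j)) ≤
      (2 * Real.pi ^ (2 * r)) ^ d * 4 ^ (r * ∑ j, u j) := by
  have h : ∀ n : ℕ, 1 + |2 * Real.pi * (levelFreq n : ℝ)| ^ (2 * r) ≤
      2 * Real.pi ^ (2 * r) * 4 ^ (r * n) := by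
    intro n
    -- Equality holds for `n ≥ 1`, as `2π · 2^(n-1) = π · 2^n`.
    have h1 : |2 * Real.pi * (levelFreq n : ℝ)| ≤ Real.pi * 2 ^ n := by
      cases n with
      | zero => simpa [levelFreq] using Real.pi_pos.le
      | succ n =>
        rw [levelFreq, if_neg n.succ_ne_zero, Nat.add_sub_cancel, abs_of_nonneg (by positivity)]
        push_cast
        rw [pow_succ]
        linarith
    have h2 : (Real.pi * 2 ^ n) ^ (2 * r) = Real.pi ^ (2 * r) * 4 ^ (r * n) := by
      rw [mul_pow, show (4 : ℝ) = 2 ^ 2 by norm_num, ← pow_mul, ← pow_mul]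
      congr 2
      ring
    have h3 : (1 : ℝ) ≤ Real.pi ^ (2 * r) * 4 ^ (r * n) :=
      one_le_mul_of_one_le_of_one_le (one_le_pow₀ (by linarith [Real.pi_gt_three]))
        (one_le_pow₀ (by norm_num))
    have h4 := pow_le_pow_left₀ (abs_nonneg _) h1 (2 * r)
    rw [h2] at h4
    linarith
  calc _ ≤ ∏ j, 2 * Real.pi ^ (2 * r) * 4 ^ (r * u j) :=
        Finset.prod_le_prod (fun _ _ => by positivity) fun j _ => h (u j)
    _ = _ := by
      rw [Finset.prod_mul_distrib, Finset.prod_pow_eq_pow_sum, ← Finset.mul_sum]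
      simp

/-- The trigonometric polynomial `∑ u ∈ T, a u cos(2π k_u⬝x)`. -/
def cosSum {d : ℕ} (T : Finset (Fin d → ℕ)) (a : (Fin d → ℕ) → ℝ) (x : UnitAddTorus (Fin d)) : ℝ :=
  ∑ u ∈ T, a u * (UnitAddTorus.mFourier (fun j => levelFreq (u j)) x).re

/-- Cosines rather than characters keep the function real, so that it serves for both scalar fields.
Each splits its coefficient equally between a frequency and its negative; if these coincide, the
halves add up. -/
theorem torusFourierCoeff_cosSum (𝕜 : Type*) [RCLike 𝕜] {d : ℕ} (T : Finset (Fin d → ℕ))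
    (a : (Fin d → ℕ) → ℝ) (k : Fin d → ℤ) :
    torusFourierCoeff (fun x => ((cosSum T a x : ℝ) : 𝕜)) k =
      ∑ u ∈ T, (a u : ℂ) * (((if k = fun j => levelFreq (u j) then 1 else 0) +
        (if k = -fun j => levelFreq (u j) then 1 else 0)) / 2) := by
  have h : ∀ x, UnitAddTorus.mFourier (-k) x * ((cosSum T a x : ℝ) : ℂ) =
      ∑ u ∈ T, (a u : ℂ) * ((UnitAddTorus.mFourier ((fun j => levelFreq (u j)) - k) x +
        UnitAddTorus.mFourier (-(fun j => levelFreq (u j)) - k) x) / 2) := by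
    intro x
    rw [cosSum]
    push_cast
    rw [Finset.mul_sum]
    refine Finset.sum_congr rfl fun u _ => ?_
    rw [Complex.re_eq_add_conj, ← UnitAddTorus.mFourier_neg, sub_eq_add_neg, sub_eq_add_neg,
      UnitAddTorus.mFourier_add, UnitAddTorus.mFourier_add]
    ring
  have hi : ∀ l : Fin d → ℤ, Integrable (fun x => UnitAddTorus.mFourier l x) (torusMeasure d) :=
    fun l => integrable_of_continuous (by fun_prop)
  simp only [torusFourierCoeff_eq, rclikeMap_ofReal, h]
  rw [integral_finsetSum _ fun u _ => integrable_of_continuous (by fun_prop)]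
  refine Finset.sum_congr rfl fun u _ => ?_
  rw [integral_const_mul, integral_div, integral_add (hi _) (hi _), integral_mFourier,
    integral_mFourier]
  simp only [sub_eq_zero, eq_comm]

/-- A frequency determines its levels, also up to sign, so distinct cosines have disjoint spectra.
-/
theorem sum_indicator_le_one {d : ℕ} (T : Finset (Fin d → ℕ)) (k : Fin d → ℤ) :
    ∑ u ∈ T, (((if k = fun j => levelFreq (u j) then 1 else 0) +
        (if k = -fun j => levelFreq (u j) then 1 else 0)) / 2 : ℝ) ≤ 1 := by
  calc _ ≤ ∑ u ∈ T, (if u = fun j => freqLevel (k j) then (1 : ℝ) else 0) := by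
        refine Finset.sum_le_sum fun u _ => ?_
        have h1 : (k = fun j => levelFreq (u j)) → u = fun j => freqLevel (k j) := by
          rintro rfl; simp only [freqLevel_levelFreq]
        have h2 : (k = -fun j => levelFreq (u j)) → u = fun j => freqLevel (k j) := by
          rintro rfl; simp only [Pi.neg_apply, freqLevel_neg, freqLevel_levelFreq]
        split_ifs <;> first | tauto | norm_num
    _ ≤ 1 := by rw [Finset.sum_ite_eq']; split_ifs <;> norm_num

/-- Pairs the spectrum of a cosine sum with a function `g` symmetric on it. It is applied over `ℝ`
to the weights and over `ℂ` to the constant `1` and to the character errors. -/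
theorem hasSum_indicator_mul {R : Type*} [Field R] [CharZero R] [TopologicalSpace R]
    [IsTopologicalRing R] {d : ℕ} (T : Finset (Fin d → ℕ)) (a b : (Fin d → ℕ) → R)
    (g : (Fin d → ℤ) → R) (hp : ∀ u ∈ T, g (fun j => levelFreq (u j)) = b u)
    (hn : ∀ u ∈ T, g (-fun j => levelFreq (u j)) = b u) :
    HasSum (fun k => (∑ u ∈ T, a u * (((if k = fun j => levelFreq (u j) then 1 else 0) +
        (if k = -fun j => levelFreq (u j) then 1 else 0)) / 2)) * g k) (∑ u ∈ T, a u * b u) := by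
  simp only [Finset.sum_mul]
  refine hasSum_sum fun u hu => ?_
  have h1 := ((hasSum_ite_eq (fun j => levelFreq (u j)) (b u)).add
    (hasSum_ite_eq (-fun j => levelFreq (u j)) (b u))).mul_left (a u / 2)
  have e : a u / 2 * (b u + b u) = a u * b u := by field_simp; ring
  rw [e] at h1
  refine h1.congr_fun fun k => ?_
  have e1 : (if k = fun j => levelFreq (u j) then 1 else 0) * g k =
      if k = fun j => levelFreq (u j) then b u else 0 := by
    split_ifs with h
    · rw [h, hp u hu, one_mul]
    · rw [zero_mul]
  have e2 : (if k = -fun j => levelFreq (u j) then 1 else 0) * g k =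
      if k = -fun j => levelFreq (u j) then b u else 0 := by
    split_ifs with h
    · rw [h, hn u hu, one_mul]
    · rw [zero_mul]
  rw [← e1, ← e2]
  ring

theorem mixNorm_cosSum_le (𝕜 : Type*) [RCLike 𝕜] {d r : ℕ} (T : Finset (Fin d → ℕ))
    {a : (Fin d → ℕ) → ℝ} {A W : ℝ} (ha : ∀ u ∈ T, |a u| = A)
    (hW : ∀ u ∈ T, mixWeight r (fun j => levelFreq (u j)) ≤ W) (h : A ^ 2 * (T.card * W) ≤ 1) :
    mixNorm r (fun x => ((cosSum T a x : ℝ) : 𝕜)) ≤ 1 := by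
  set p : (Fin d → ℤ) → ℝ := fun k => ∑ u ∈ T, 1 *
    (((if k = fun j => levelFreq (u j) then 1 else 0) +
        (if k = -fun j => levelFreq (u j) then 1 else 0)) / 2) with hp
  have hp0 : ∀ k, 0 ≤ p k := fun k => Finset.sum_nonneg fun u _ => by split_ifs <;> norm_num
  have hp1 : ∀ k, p k ≤ 1 := fun k => by
    simpa only [hp, one_mul] using sum_indicator_le_one T k
  have hA : ∀ k, ‖torusFourierCoeff (fun x => ((cosSum T a x : ℝ) : 𝕜)) k‖ ≤ |A| * p k := by
    intro k
    rw [torusFourierCoeff_cosSum, hp, Finset.mul_sum]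
    refine (norm_sum_le _ _).trans (Finset.sum_le_sum fun u hu => ?_)
    rw [norm_mul, Complex.norm_real, Real.norm_eq_abs, ha u hu, one_mul]
    refine mul_le_mul (le_abs_self A) ?_ (norm_nonneg _) (abs_nonneg A)
    split_ifs <;> norm_num
  have hs : HasSum (fun k => p k * mixWeight r k)
      (∑ u ∈ T, 1 * mixWeight r (fun j => levelFreq (u j))) :=
    hasSum_indicator_mul T (fun _ => 1) (fun u => mixWeight r fun j => levelFreq (u j))
      (mixWeight r) (fun _ _ => rfl) fun _ _ => mixWeight_neg r _
  refine ENNReal.rpow_le_one ?_ (by norm_num)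
  calc _ ≤ ∑' k, ENNReal.ofReal (A ^ 2 * (p k * mixWeight r k)) := by
        refine ENNReal.tsum_le_tsum fun k => ENNReal.ofReal_le_ofReal ?_
        -- Since `0 ≤ p k ≤ 1`, the square `p k ^ 2` is at most `p k`, and the norm becomes linear
        -- in `p`.
        have h1 : ‖torusFourierCoeff (fun x => ((cosSum T a x : ℝ) : 𝕜)) k‖ ^ 2 ≤ A ^ 2 * p k := by
          refine (pow_le_pow_left₀ (norm_nonneg _) (hA k) 2).trans ?_
          rw [mul_pow, sq_abs, sq (p k)]
          exact mul_le_mul_of_nonneg_left (mul_le_of_le_one_left (hp0 k) (hp1 k)) (sq_nonneg A)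
        calc _ ≤ mixWeight r k * (A ^ 2 * p k) :=
              mul_le_mul_of_nonneg_left h1 (mixWeight_pos r k).le
          _ = _ := by ring
    _ = ENNReal.ofReal (A ^ 2 * ∑ u ∈ T, 1 * mixWeight r (fun j => levelFreq (u j))) := by
        rw [← ENNReal.ofReal_tsum_of_nonneg _ (hs.mul_left _).summable, (hs.mul_left _).tsum_eq]
        intro k
        exact mul_nonneg (sq_nonneg A) (mul_nonneg (hp0 k) (mixWeight_pos r k).le)
    _ ≤ 1 := by
        rw [ENNReal.ofReal_le_one]
        refine le_trans (mul_le_mul_of_nonneg_left ?_ (sq_nonneg A)) h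
        simp only [one_mul]
        exact (Finset.sum_le_card_nsmul _ _ _ hW).trans_eq (nsmul_eq_mul _ _)

theorem le_worstCaseError (𝕜 : Type*) [RCLike 𝕜] {r : ℕ} (d L : ℕ) {W : ℝ} (hW0 : 0 < W)
    (hW : ∀ u : Fin d → ℕ, ∑ j, u j = L + 1 → mixWeight r (fun j => levelFreq (u j)) ≤ W) :
    ENNReal.ofReal (Real.sqrt (((Finset.univ : Finset (Fin d)).piAntidiag (L + 1)).card / W)) ≤
      worstCaseError 𝕜 r (sparseGridRule d L) := by
  set T := (Finset.univ : Finset (Fin d)).piAntidiag (L + 1) with hT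
  have hTs : ∀ u ∈ T, ∑ j, u j = L + 1 := fun u hu => by simpa [hT] using hu
  rcases T.card.eq_zero_or_pos with h0 | hM
  · simp [h0]
  have hM' : (0 : ℝ) < T.card := by exact_mod_cast hM
  -- The signs are the character errors at total level `L + 1`, so each cosine contributes `+A` to
  -- the error.
  let s : (Fin d → ℕ) → ℝ := fun u => ∏ j, if u j = 0 then 1 else -1
  have hs : ∀ u, |s u| = 1 := fun u => by
    rw [Finset.abs_prod]
    exact Finset.prod_eq_one fun j _ => by split_ifs <;> simp
  -- The largest amplitude that the weight bound `W` allows in the unit ball; the total error is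
  -- then `A * T.card = √(T.card / W)`.
  let A : ℝ := (Real.sqrt (T.card * W))⁻¹
  have hA : 0 < A := by positivity
  have hA2 : A ^ 2 * (T.card * W) = 1 := by
    rw [inv_pow, Real.sq_sqrt (by positivity)]
    exact inv_mul_cancel₀ (by positivity)
  let a : (Fin d → ℕ) → ℝ := fun u => A * s u
  let f : UnitAddTorus (Fin d) → 𝕜 := fun x => ((cosSum T a x : ℝ) : 𝕜)
  have hcont : Continuous f := by
    refine RCLike.continuous_ofReal.comp ?_
    unfold cosSum
    fun_prop
  have hnorm : mixNorm r f ≤ 1 := by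
    refine mixNorm_cosSum_le 𝕜 T (A := A) (W := W) (fun u _ => ?_) (fun u hu => hW u (hTs u hu))
      hA2.le
    rw [abs_mul, hs, mul_one, abs_of_pos hA]
  have hsummable : Summable (torusFourierCoeff f) := by
    have := (hasSum_indicator_mul T (fun u => (a u : ℂ)) (fun _ => 1) (fun _ => 1)
      (fun _ _ => rfl) fun _ _ => rfl).summable
    refine this.congr fun k => ?_
    rw [mul_one, torusFourierCoeff_cosSum]
  have hE := hasSum_torusFourierCoeff_mul_charError hcont hsummable L
  have hE' := hasSum_indicator_mul T (fun u => (a u : ℂ)) (fun u => (s u : ℂ)) (charError d L)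
    (fun u hu => charError_eq_sign (fun j => freqLevel_levelFreq (u j)) (hTs u hu))
    (fun u hu => charError_eq_sign
      (fun j => by rw [Pi.neg_apply, freqLevel_neg, freqLevel_levelFreq]) (hTs u hu))
  have hval : RCLike.map 𝕜 ℂ (torusIntegral f - (sparseGridRule d L).apply f) =
      ((A * T.card : ℝ) : ℂ) := by
    have h1 : ∀ u ∈ T, a u * s u = A := fun u _ => by
      rw [mul_assoc, ← sq, ← sq_abs, hs, one_pow, mul_one]
    have h2 : ∑ u ∈ T, a u * s u = A * T.card := by
      rw [Finset.sum_congr rfl h1, Finset.sum_const, nsmul_eq_mul, mul_comm]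
    rw [← h2]
    push_cast
    refine hE.unique (hE'.congr_fun fun k => ?_)
    rw [torusFourierCoeff_cosSum]
  have herr : ‖torusIntegral f - (sparseGridRule d L).apply f‖ₑ =
      ENNReal.ofReal (Real.sqrt (T.card / W)) := by
    rw [← ofReal_norm, ← norm_rclikeMap, hval, Complex.norm_real, Real.norm_eq_abs,
      abs_of_pos (by positivity)]
    congr 1
    refine ((Real.sqrt_eq_iff_eq_sq (by positivity) (by positivity)).mpr ?_).symm
    symm
    rw [mul_pow, eq_div_iff hW0.ne']
    calc _ = (A ^ 2 * (T.card * W)) * T.card := by ring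
      _ = _ := by rw [hA2, one_mul]
  rw [← herr]
  exact le_iSup₂_of_le f ⟨⟨hcont, hnorm.trans_lt ENNReal.one_lt_top⟩, hnorm⟩ le_rfl

/-! ### The rate in terms of the level -/

/-- The order `2^(-rL) (L+1)^(m/2)` of the error at level `L` in dimension `m + 1`. -/
def levelRate (m r L : ℕ) : ℝ := (1 / 2) ^ (r * L) * Real.sqrt ((L + 1) ^ m)

/-- The first base is the order of the number of nodes. Its factor `(L+1)^(-mr)` is compensated by
the exponent `m(r + 1/2)`, leaving the square root. -/
theorem levelRate_eq (m r L : ℕ) : levelRate m r L =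
    ((L + 1 : ℝ) ^ m * 2 ^ L) ^ (-(r : ℝ)) * (L + 1 : ℝ) ^ ((m : ℝ) * ((r : ℝ) + 1 / 2)) := by
  have h : (0 : ℝ) < L + 1 := by positivity
  have h2 : ((L + 1 : ℝ) ^ m * 2 ^ L) ^ (-(r : ℝ)) =
      (L + 1 : ℝ) ^ (-((m : ℝ) * r)) * (1 / 2) ^ (r * L) := by
    rw [Real.mul_rpow (by positivity) (by positivity), ← Real.rpow_natCast, ← Real.rpow_mul h.le,
      mul_neg, Real.rpow_neg (by positivity) (r : ℝ), Real.rpow_natCast, ← pow_mul, mul_comm L r,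
      one_div, inv_pow]
  have h3 : Real.sqrt ((L + 1 : ℝ) ^ m) = (L + 1 : ℝ) ^ ((m : ℝ) / 2) := by
    rw [Real.sqrt_eq_rpow, ← Real.rpow_natCast, ← Real.rpow_mul h.le]
    ring_nf
  rw [levelRate, h2, h3, mul_comm ((L + 1 : ℝ) ^ _), mul_assoc, ← Real.rpow_add h]
  ring_nf

theorem log_numNodes_bounds (m : ℕ) {L : ℕ} (hL : 1 ≤ L) :
    Real.log 2 / 2 * (L + 1) ≤ Real.log (numNodes (m + 1) L) ∧
      Real.log (numNodes (m + 1) L) ≤ (m + 1) * (L + 1) := by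
  have hlog2 : 0 < Real.log 2 := Real.log_pos one_lt_two
  have hlog2' : Real.log 2 ≤ 1 := by linarith [Real.log_two_lt_d9]
  have h1 : (2 : ℝ) ^ L ≤ numNodes (m + 1) L := by exact_mod_cast two_pow_le_numNodes m L
  have h2 : (numNodes (m + 1) L : ℝ) ≤ 2 * (((L : ℝ) + 1) ^ m * 2 ^ L) := by
    exact_mod_cast numNodes_le m L
  have h0 : (0 : ℝ) < 2 ^ L := by positivity
  have hL' : (1 : ℝ) ≤ L := by exact_mod_cast hL
  constructor
  -- `(L + 1) / 2 ≤ L` needs `L ≥ 1`; at `L = 0` there is one node and the logarithm vanishes.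
  · calc _ ≤ L * Real.log 2 := by nlinarith
      _ = Real.log (2 ^ L) := (Real.log_pow _ _).symm
      _ ≤ _ := Real.log_le_log h0 h1
  · have hlogL : Real.log ((L : ℝ) + 1) ≤ (L : ℝ) + 1 :=
      (Real.log_le_sub_one_of_pos (by positivity)).trans (by linarith)
    calc _ ≤ Real.log (2 * (((L : ℝ) + 1) ^ m * 2 ^ L)) := Real.log_le_log (h0.trans_le h1) h2
      _ = Real.log 2 + (m * Real.log ((L : ℝ) + 1) + L * Real.log 2) := by
        rw [Real.log_mul (by positivity) (by positivity),
          Real.log_mul (by positivity) (by positivity), Real.log_pow, Real.log_pow]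
      _ ≤ 1 + (m * ((L : ℝ) + 1) + L * 1) := by gcongr
      _ = _ := by ring

theorem exists_sparseGridRate_bounds (m r : ℕ) : ∃ p q : ℝ, 0 < p ∧ 0 < q ∧ ∀ L : ℕ, 1 ≤ L →
    p * levelRate m r L ≤ sparseGridRate (m + 1) r (numNodes (m + 1) L) ∧
      sparseGridRate (m + 1) r (numNodes (m + 1) L) ≤ q * levelRate m r L := by
  set a : ℝ := (m : ℝ) * ((r : ℝ) + 1 / 2) with ha
  have ha0 : 0 ≤ a := by positivity
  have hlog2 : 0 < Real.log 2 := Real.log_pos one_lt_two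
  set D : ℝ := ((m : ℝ) + 1) ^ m * 2 ^ (m + 1) with hD
  have hD0 : 0 < D := by positivity
  -- As `N` has the exponent `-r`, the upper bound `2X` on `N` enters `p` and the lower bound `X /
  -- D` enters `q`; the other factors come from `log_numNodes_bounds`.
  refine ⟨2 ^ (-(r : ℝ)) * (Real.log 2 / 2) ^ a, D⁻¹ ^ (-(r : ℝ)) * ((m : ℝ) + 1) ^ a,
    by positivity, by positivity, fun L hL => ?_⟩
  obtain ⟨hl1, hl2⟩ := log_numNodes_bounds m hL
  set N : ℝ := ((numNodes (m + 1) L : ℕ) : ℝ) with hN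
  set X : ℝ := ((L : ℝ) + 1) ^ m * 2 ^ L with hX
  have hX0 : 0 < X := by positivity
  have hL0 : (0 : ℝ) < L + 1 := by positivity
  have hN1 : N ≤ 2 * X := by rw [hN, hX]; exact_mod_cast numNodes_le m L
  have hN2 : D⁻¹ * X ≤ N := by
    rw [inv_mul_le_iff₀ hD0, hN, hX, hD]
    exact_mod_cast le_numNodes m L
  have hN0 : 0 < N := lt_of_lt_of_le (by positivity) hN2
  have hlog0 : 0 ≤ Real.log N := le_trans (by positivity) hl1
  have hr0 : -(r : ℝ) ≤ 0 := by simp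
  have hrate : sparseGridRate (m + 1) r (numNodes (m + 1) L) =
      N ^ (-(r : ℝ)) * Real.log N ^ a := by
    rw [sparseGridRate, ha]; push_cast; rw [add_sub_cancel_right]
  rw [hrate, levelRate_eq]
  constructor
  · calc _ = (2 * X) ^ (-(r : ℝ)) * (Real.log 2 / 2 * (L + 1)) ^ a := by
          rw [Real.mul_rpow two_pos.le hX0.le, Real.mul_rpow (by positivity) hL0.le]; ring
      _ ≤ _ := mul_le_mul (Real.rpow_le_rpow_of_nonpos hN0 hN1 hr0)
          (Real.rpow_le_rpow (by positivity) hl1 ha0) (by positivity) (by positivity)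
  · calc _ ≤ (D⁻¹ * X) ^ (-(r : ℝ)) * (((m : ℝ) + 1) * (L + 1)) ^ a :=
          mul_le_mul (Real.rpow_le_rpow_of_nonpos (by positivity) hN2 hr0)
            (Real.rpow_le_rpow hlog0 hl2 ha0) (by positivity) (by positivity)
      _ = _ := by
          rw [Real.mul_rpow (inv_pos.mpr hD0).le hX0.le, Real.mul_rpow (by positivity) hL0.le]; ring

/-! ### Two-sided bounds for the worst-case error -/

theorem exists_worstCaseError_le (𝕜 : Type*) [RCLike 𝕜] {r : ℕ} (hr : 1 ≤ r) (m : ℕ) :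
    ∃ C : ℝ, 0 < C ∧ ∀ L : ℕ,
      worstCaseError 𝕜 r (sparseGridRule (m + 1) L) ≤ ENNReal.ofReal (C * levelRate m r L) := by
  obtain ⟨K, hK, hKn⟩ := exists_weightTail_le hr m
  set B : ℝ := (1 + 2 ^ (m + 1)) ^ 2 * (K.toReal * 2 ^ m) with hB
  -- `B + 1` instead of `B` keeps the constant positive even if `K = 0`.
  refine ⟨Real.sqrt (B + 1), by positivity, fun L => (worstCaseError_le 𝕜 hr m L).trans ?_⟩
  have h1 : weightTail r (m + 1) (L + 1) ≤
      ENNReal.ofReal (K.toReal * 2 ^ m * ((L : ℝ) + 1) ^ m * ((1 / 2) ^ (r * L)) ^ 2) := by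
    refine (hKn (L + 1)).trans ?_
    have e : K * ((L + 1 : ℕ) + 1 : ℝ≥0∞) ^ m * ratio r ^ (L + 1) =
        ENNReal.ofReal (K.toReal * (((L + 1 : ℕ) : ℝ) + 1) ^ m * ((1 / 4) ^ r) ^ (L + 1)) := by
      rw [ENNReal.ofReal_mul (by positivity), ENNReal.ofReal_mul (by positivity),
        ENNReal.ofReal_toReal hK, ENNReal.ofReal_pow (by positivity),
        ENNReal.ofReal_add (by positivity) zero_le_one, ENNReal.ofReal_natCast, ENNReal.ofReal_one,
        ENNReal.ofReal_pow (by positivity), ratio]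
    rw [e]
    refine ENNReal.ofReal_le_ofReal ?_
    have e2 : (((1 : ℝ) / 2) ^ (r * L)) ^ 2 = ((1 / 4) ^ r) ^ L := by
      rw [show (1 / 4 : ℝ) = (1 / 2) ^ 2 by norm_num, ← pow_mul, ← pow_mul, ← pow_mul]
      congr 1
      ring
    rw [e2, mul_assoc K.toReal (2 ^ m), ← mul_pow]
    have h4 : ((L + 1 : ℕ) : ℝ) + 1 ≤ 2 * ((L : ℝ) + 1) := by
      push_cast; linarith [(Nat.cast_nonneg L : (0 : ℝ) ≤ L)]
    have h5 : (((1 : ℝ) / 4) ^ r) ^ (L + 1) ≤ ((1 / 4) ^ r) ^ L :=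
      pow_le_pow_of_le_one (by positivity) (pow_le_one₀ (by norm_num) (by norm_num)) (Nat.le_succ L)
    gcongr K.toReal * ?_ ^ m * ?_
  have h2 : Real.sqrt (B + 1) * levelRate m r L =
      (((B + 1) * (((L : ℝ) + 1) ^ m * ((1 / 2) ^ (r * L)) ^ 2))) ^ (1 / 2 : ℝ) := by
    rw [← Real.sqrt_eq_rpow, levelRate, Real.sqrt_mul (by positivity),
      Real.sqrt_mul (by positivity), Real.sqrt_sq (by positivity)]
    ring
  rw [h2, ← ENNReal.ofReal_rpow_of_nonneg (by positivity) (by norm_num)]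
  gcongr
  refine (mul_le_mul_right h1 _).trans ?_
  rw [← ENNReal.ofReal_mul (by positivity)]
  refine ENNReal.ofReal_le_ofReal ?_
  have h3 : 0 ≤ ((L : ℝ) + 1) ^ m * ((1 / 2) ^ (r * L)) ^ 2 := by positivity
  calc _ = B * (((L : ℝ) + 1) ^ m * ((1 / 2) ^ (r * L)) ^ 2) := by rw [hB]; ring
    _ ≤ _ := by nlinarith

theorem exists_le_worstCaseError (𝕜 : Type*) [RCLike 𝕜] (m r : ℕ) :
    ∃ c : ℝ, 0 < c ∧ ∀ L : ℕ,
      ENNReal.ofReal (c * levelRate m r L) ≤ worstCaseError 𝕜 r (sparseGridRule (m + 1) L) := by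
  set D : ℝ := (2 * Real.pi ^ (2 * r)) ^ (m + 1) with hD
  have hD0 : 0 < D := by positivity
  -- `(m+1)^m` comes from counting compositions, `D` from the weight bound, and `4^r` from working
  -- at total level `L + 1` instead of `L`.
  set c : ℝ := (((m : ℝ) + 1) ^ m * (D * 4 ^ r))⁻¹ with hc
  refine ⟨Real.sqrt c, by positivity, fun L => ?_⟩
  have hW0 : 0 < D * 4 ^ (r * (L + 1)) := by positivity
  refine le_trans (ENNReal.ofReal_le_ofReal ?_) (le_worstCaseError 𝕜 (m + 1) L hW0 fun u hu => ?_)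
  · have h1 : ((L + 1 : ℝ) + 1) ^ m ≤ ((m : ℝ) + 1) ^ m *
        ((Finset.univ : Finset (Fin (m + 1))).piAntidiag (L + 1)).card := by
      exact_mod_cast le_card_piAntidiag m (L + 1)
    have h2 : Real.sqrt c * levelRate m r L =
        Real.sqrt (c * (((1 / 2) ^ (r * L)) ^ 2 * ((L : ℝ) + 1) ^ m)) := by
      rw [levelRate, Real.sqrt_mul (by positivity), Real.sqrt_mul (by positivity),
        Real.sqrt_sq (by positivity)]
    rw [h2]
    refine Real.sqrt_le_sqrt ?_
    have e2 : (((1 : ℝ) / 2) ^ (r * L)) ^ 2 = (4 ^ (r * L))⁻¹ := by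
      rw [one_div, inv_pow, inv_pow, ← pow_mul, mul_comm _ 2, pow_mul]
      norm_num
    have h3 : ((L : ℝ) + 1) ^ m ≤ ((L + 1 : ℝ) + 1) ^ m := by gcongr; linarith
    rw [le_div_iff₀ hW0]
    calc _ = (((m : ℝ) + 1) ^ m)⁻¹ * ((L : ℝ) + 1) ^ m := by
          rw [e2, hc, mul_add, mul_one, pow_add]
          field_simp
      _ ≤ _ := by
          rw [inv_mul_le_iff₀ (by positivity)]
          exact h3.trans h1
  · rw [← hu]
    exact mixWeight_levelFreq_le r u

end SparseGrid

end

theorem mainTheorem7 (𝕜 : Type*) [RCLike 𝕜] (d r : ℕ) (hd : 1 ≤ d) (hr : 1 ≤ r) :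
    ∃ c C : ℝ, 0 < c ∧ 0 < C ∧ ∀ L : ℕ, 1 ≤ L →
      ENNReal.ofReal (c * SparseGrid.sparseGridRate d r (SparseGrid.numNodes d L)) ≤
          SparseGrid.worstCaseError 𝕜 r (SparseGrid.sparseGridRule d L) ∧
        SparseGrid.worstCaseError 𝕜 r (SparseGrid.sparseGridRule d L) ≤
          ENNReal.ofReal (C * SparseGrid.sparseGridRate d r (SparseGrid.numNodes d L)) := by
  obtain ⟨m, rfl⟩ := Nat.exists_eq_add_of_le' hd
  obtain ⟨p, q, hp, hq, hpq⟩ := SparseGrid.exists_sparseGridRate_bounds m r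
  obtain ⟨C, hC, hupper⟩ := SparseGrid.exists_worstCaseError_le 𝕜 hr m
  obtain ⟨c, hc, hlower⟩ := SparseGrid.exists_le_worstCaseError 𝕜 m r
  refine ⟨c / q, C / p, by positivity, by positivity, fun L hL => ⟨?_, ?_⟩⟩
  · refine le_trans (ENNReal.ofReal_le_ofReal ?_) (hlower L)
    rw [div_mul_eq_mul_div, div_le_iff₀ hq, mul_assoc, mul_comm _ q]
    exact mul_le_mul_of_nonneg_left (hpq L hL).2 hc.le
  · refine (hupper L).trans (ENNReal.ofReal_le_ofReal ?_)
    rw [div_mul_eq_mul_div, le_div_iff₀ hp, mul_assoc, mul_comm _ p]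
    exact mul_le_mul_of_nonneg_left (hpq L hL).1 hC.le
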